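/- Let $[n]=\{1,\dots,n\}$. A family $\mathcal G\subset 2^{[n]}$ is called $3$-wise $t$-intersecting if $|G_1\cap G_2\cap G_3|\ge t$ for all (not necessarily distinct) $G_1,G_2,G_3\in\mathcal G$. For $0<p<1$ its $p$-biased measure is $\mu_p(\mathcal G)=\sum_{G\in\mathcal G}p^{|G|}(1-p)^{n-|G|}$. Two families $\mathcal F,\mathcal H\subset 2^{[n]}$ are isomorphic, $\mathcal F\cong\mathcal H$, if $\mathcal H=\{\tau(F):F\in\mathcal F\}$ for some permutation $\tau$ of $[n]$. For an integer $i\ge 0$ with $t+3i\le n$ let $\mathcal F_i^t=\{F\subset[n]:|F\cap[t+3i]|\ge t+2i\}$, and for integers $t\ge 1$ let $p_0(t)=\frac{2}{\sqrt{4t+9}-1}$. **Theorem.** For every real $\delta>0$ there exists an integer $t_0\ge 0$ such that for all integers $t>t_0$ and all real $p$ with $0<p\le p_0(t)$ the following holds. For every $n$, if $\mathcal G\subset 2^{[n]}$ is a $3$-wise $t$-intersecting family with $\mu_p(\mathcal G)\ge\left(\frac12+\delta\right)p^t$, then there is a family $\mathcal F\subset 2^{[n]}$ with $\mathcal G\subset\mathcal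 F$ such that either $t\le n$ and $\mathcal F\cong\mathcal F_0^t$, or $t+3\le n$ and $\mathcal F\cong\mathcal F_1^t$. -/

import Mathlib

/-- A family `G` of subsets of `X` is `r`-wise `t`-intersecting if
`|G₁ ∩ ⋯ ∩ G_r| ≥ t` for all (not necessarily distinct) members `G₁, …, G_r` of `G`. -/
def WiseIntersecting {X : Type*} [Fintype X] [DecidableEq X]
    (r t : ℕ) (G : Finset (Finset X)) : Prop :=
  ∀ g : Fin r → Finset X, (∀ k, g k ∈ G) → t ≤ (Finset.univ.inf g).card

/-- The `p`-biased measure `μ_p(G : X) = ∑_{A ∈ G} p^|A| (1 - p)^(|X| - |A|)`.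
Here `A ⊆ X`, so the natural subtraction does not truncate. -/
noncomputable def biasedMeasure {X : Type*} [Fintype X]
    (p : ℝ) (G : Finset (Finset X)) : ℝ :=
  ∑ A ∈ G, p ^ A.card * (1 - p) ^ (Fintype.card X - A.card)

/-- Two families are isomorphic if a permutation of the ground set carries one to the other. -/
def FamilyIso {X : Type*} [DecidableEq X] (G H : Finset (Finset X)) : Prop :=
  ∃ τ : Equiv.Perm X, H = G.image (fun A => A.image τ)

/-- The family `{F ⊆ [n] : |F ∩ [t + r i]| ≥ t + (r - 1) i}` (used for `r ≥ 1` and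
`t + r i ≤ n`). The ground set `[n]` is `Fin n`, and `[m]` consists of the elements of `Fin n`
with value less than `m`. -/
def franklFamily (n r t i : ℕ) : Finset (Finset (Fin n)) :=
  Finset.univ.filter fun F =>
    t + (r - 1) * i ≤ (F.filter fun x : Fin n => (x : ℕ) < t + r * i).card

/-- The threshold `p₀(t) = 2 / (√(4t + 9) - 1)`. -/
noncomputable def pZero (t : ℕ) : ℝ := 2 / (Real.sqrt (4 * (t : ℝ) + 9) - 1)

open Finset

/-! For `|S| = t + 3k`, `nearFull S k` is a copy of the `k`-th Frankl family. Since `p ≤ pZero t`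
gives `(t + 2) p² ≤ 1 + p`, we have `|S| p² ≤ 1 + O_k(p)`, so this family has measure at most about
`p^t / k!`. For `k ≥ 2` that is too small to contain `G` once `p` is small, and for large `k` it
decays geometrically.

The engine is an exclusion estimate, `biasedMeasure_inter_nearFull_le`: if `G` is not contained in
`nearFull S k`, it meets that family in measure only `O_k(p) p^t`. The bulk of the intersection
becomes, after symmetric difference with `S`, an intersecting family for a product measure with
small marginals.

If `G` is shifted, each member lies in `nearFull [t + 3k] k` for some `k`
(`IsShifted.exists_mem_nearFull`). Were `G` in none of these families, summing the exclusion
estimate for small `k` and the tail bound for large `k` would give measure at most `p^t / 4`. So `G`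
lies in one of them, and its measure forces `k ≤ 1`.

For general `G`, undo shifts one at a time: if the shift lies in `nearFull S k`, then `G` lies in
the union of two copies, and the exclusion estimate applied to both forces `G` into one of them. -/

theorem biasedMeasure_eq_sum_prod {X : Type*} [Fintype X] [DecidableEq X]
    (p : ℝ) (G : Finset (Finset X)) :
    biasedMeasure p G = ∑ A ∈ G, ∏ x, if x ∈ A then p else 1 - p := by
  unfold biasedMeasure
  refine sum_congr rfl fun A _ => ?_
  rw [prod_ite, prod_const, prod_const, filter_mem_eq_inter, univ_inter,
    ← card_compl, compl_eq_univ_sdiff]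
  congr 3
  ext x; simp

/-! ### Biased measure: union bounds and near-full families -/

section Basic

variable {X : Type*} [Fintype X] {p : ℝ}

theorem biasedMeasure_mono (hp : 0 ≤ p) (hp1 : p ≤ 1) {G H : Finset (Finset X)} (h : G ⊆ H) :
    biasedMeasure p G ≤ biasedMeasure p H :=
  sum_le_sum_of_subset_of_nonneg h fun _ _ _ =>
    mul_nonneg (pow_nonneg hp _) (pow_nonneg (by linarith) _)

theorem biasedMeasure_biUnion_le [DecidableEq X] {ι : Type*} (hp : 0 ≤ p) (hp1 : p ≤ 1)
    (I : Finset ι) (F : ι → Finset (Finset X)) :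
    biasedMeasure p (I.biUnion F) ≤ ∑ i ∈ I, biasedMeasure p (F i) := by
  classical
  induction I using Finset.induction_on with
  | empty => simp [biasedMeasure]
  | insert a I ha ih =>
    rw [biUnion_insert, sum_insert ha]
    refine le_trans ?_ (add_le_add le_rfl ih)
    unfold biasedMeasure
    rw [← sum_union_inter]
    exact le_add_of_nonneg_right (sum_nonneg fun _ _ =>
      mul_nonneg (pow_nonneg hp _) (pow_nonneg (by linarith) _))

theorem biasedMeasure_union_le [DecidableEq X] (hp : 0 ≤ p) (hp1 : p ≤ 1)
    (G H : Finset (Finset X)) :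
    biasedMeasure p (G ∪ H) ≤ biasedMeasure p G + biasedMeasure p H := by
  unfold biasedMeasure
  rw [← sum_union_inter]
  exact le_add_of_nonneg_right (sum_nonneg fun _ _ =>
    mul_nonneg (pow_nonneg hp _) (pow_nonneg (by linarith) _))

theorem biasedMeasure_superset [DecidableEq X] (W : Finset X) :
    biasedMeasure p (univ.filter fun A => W ⊆ A) = p ^ W.card := by
  -- Giving absence weight `0` on `W` kills exactly the sets that do not contain `W`.
  have h := prod_add (fun _ : X => p) (fun x => if x ∈ W then 0 else 1 - p) univ
  have h1 : ∏ x : X, (p + if x ∈ W then 0 else 1 - p) = p ^ W.card := by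
    have : ∀ x : X, (p + if x ∈ W then 0 else 1 - p) = if x ∈ W then p else 1 := by
      intro x; split_ifs <;> ring
    simp only [this, prod_ite_mem, univ_inter, prod_const]
  rw [h1] at h
  rw [h, biasedMeasure, sum_filter, powerset_univ]
  refine sum_congr rfl fun A _ => ?_
  rw [prod_const]
  split_ifs with hW
  · congr 1
    rw [← card_univ, ← card_sdiff_of_subset (subset_univ A), ← prod_const]
    refine prod_congr rfl fun x hx => ?_
    rw [if_neg fun hxW => (mem_sdiff.1 hx).2 (hW hxW)]
  · obtain ⟨x, hxW, hxA⟩ := not_subset.1 hW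
    rw [prod_eq_zero (i := x) (by simp [hxA]) (by simp [hxW]), mul_zero]

/-- The sets that contain all but at most `k` elements of `S`. -/
def nearFull [DecidableEq X] (S : Finset X) (k : ℕ) : Finset (Finset X) :=
  univ.filter fun A => (S \ A).card ≤ k

theorem mem_nearFull [DecidableEq X] {S A : Finset X} {k : ℕ} :
    A ∈ nearFull S k ↔ (S \ A).card ≤ k := by simp [nearFull]

theorem biasedMeasure_nearFull_le [DecidableEq X] (hp : 0 ≤ p) (hp1 : p ≤ 1) (S : Finset X)
    {k : ℕ} (hk : k ≤ S.card) :
    biasedMeasure p (nearFull S k) ≤ S.card.choose k * p ^ (S.card - k) := by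
  have hsub : nearFull S k ⊆
      (S.powersetCard k).biUnion fun Y => univ.filter fun A => S \ Y ⊆ A := by
    intro A hA
    rw [mem_nearFull] at hA
    obtain ⟨Y, hAY, hYS, hY⟩ := exists_subsuperset_card_eq (sdiff_subset (s := S) (t := A)) hA hk
    refine mem_biUnion.2 ⟨Y, mem_powersetCard.2 ⟨hYS, hY⟩, ?_⟩
    simp only [mem_filter, mem_univ, true_and]
    intro x hx
    by_contra hxA
    exact (mem_sdiff.1 hx).2 (hAY (mem_sdiff.2 ⟨(mem_sdiff.1 hx).1, hxA⟩))
  refine (biasedMeasure_mono hp hp1 hsub).trans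
    ((biasedMeasure_biUnion_le hp hp1 _ _).trans (le_of_eq ?_))
  rw [sum_congr rfl (g := fun _ => p ^ (S.card - k))]
  · simp
  · intro Y hY
    obtain ⟨hYS, hYc⟩ := mem_powersetCard.1 hY
    rw [biasedMeasure_superset, card_sdiff_of_subset hYS, hYc]

end Basic

/-! ### Intersecting families and the exclusion estimate -/

/-- An intersecting family has measure at most `1 / m` with respect to every product measure
whose marginals are at most `1 / m`. -/
theorem mul_sum_prod_le_one_of_intersecting {X : Type*} [Fintype X] [DecidableEq X]
    (m : ℕ) (π : X → ℝ) (hπ : ∀ x, 0 ≤ π x) (hm : ∀ x, m * π x ≤ 1)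
    (H : Finset (Finset X)) (hH : ∀ U ∈ H, ∀ V ∈ H, ¬ Disjoint U V) :
    m * ∑ U ∈ H, ∏ x, (if x ∈ U then π x else 1 - π x) ≤ 1 := by
  classical
  -- Colour each point independently, each of the `m` colours having probability `π x`. Every colour
  -- class has the product law, and the classes are disjoint, so at most one belongs to `H`; the
  -- left side is the expected number that do.
  let w : X → Option (Fin m) → ℝ := fun x o => o.elim (1 - m * π x) fun _ => π x
  have hw : ∀ x o, 0 ≤ w x o := by
    rintro x (_ | a)
    · simpa [w] using hm x
    · exact hπ x
  have hw1 : ∀ x, ∑ o, w x o = 1 := by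
    intro x; rw [Fintype.sum_option]; simp [w]
  let cls : (X → Option (Fin m)) → Fin m → Finset X := fun c a => univ.filter fun x => c x = some a
  have htot : ∑ c : X → Option (Fin m), ∏ x, w x (c x) = 1 := by
    have := prod_univ_sum (fun _ : X => (univ : Finset (Option (Fin m)))) w
    rw [Fintype.piFinset_univ] at this
    rw [← this]; simp [hw1]
  have hmarg : ∀ (a : Fin m) (U : Finset X),
      ∑ c : X → Option (Fin m), (if cls c a = U then ∏ x, w x (c x) else 0) =
        ∏ x, if x ∈ U then π x else 1 - π x := by
    intro a U
    have h := prod_univ_sum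
      (fun x : X => if x ∈ U then ({some a} : Finset (Option (Fin m))) else univ.erase (some a)) w
    have h1 : ∀ x, ∑ j ∈ (if x ∈ U then ({some a} : Finset (Option (Fin m)))
        else univ.erase (some a)), w x j = if x ∈ U then π x else 1 - π x := by
      intro x
      split_ifs
      · simp [w]
      · have := sum_erase_add univ (w x) (mem_univ (some a))
        rw [hw1] at this
        have h2 : w x (some a) = π x := rfl
        linarith
    rw [prod_congr rfl fun x _ => h1 x] at h
    rw [h, ← sum_filter]
    refine sum_congr ?_ fun _ _ => rfl
    ext c
    simp only [mem_filter, mem_univ, true_and, Fintype.mem_piFinset, cls, Finset.ext_iff]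
    refine forall_congr' fun x => ?_
    by_cases hx : x ∈ U <;> simp [hx]
  calc m * ∑ U ∈ H, ∏ x, (if x ∈ U then π x else 1 - π x)
      = ∑ a : Fin m, ∑ U ∈ H, ∑ c : X → Option (Fin m),
          (if cls c a = U then ∏ x, w x (c x) else 0) := by
        simp only [hmarg, sum_const, card_univ, Fintype.card_fin, nsmul_eq_mul]
    _ = ∑ c : X → Option (Fin m), ∑ a : Fin m, ∑ U ∈ H,
          (if cls c a = U then ∏ x, w x (c x) else 0) := by
        rw [sum_comm]
        rw [sum_congr rfl fun U _ => sum_comm, sum_comm]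
        exact sum_congr rfl fun c _ => sum_comm
    _ ≤ ∑ c : X → Option (Fin m), ∏ x, w x (c x) := by
        refine sum_le_sum fun c _ => ?_
        simp only [sum_ite_eq]
        rw [← sum_filter, sum_const, nsmul_eq_mul]
        refine mul_le_of_le_one_left (prod_nonneg fun x _ => hw x _) ?_
        norm_cast
        refine card_le_one.2 fun a ha b hb => ?_
        by_contra hab
        refine hH _ (mem_filter.1 ha).2 _ (mem_filter.1 hb).2 (disjoint_left.2 fun x hx hx' => hab ?_)
        have h1 := (mem_filter.1 hx).2
        rw [(mem_filter.1 hx').2] at h1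
        exact (Option.some.inj h1).symm
    _ = 1 := htot

theorem wiseIntersecting_three_iff {X : Type*} [Fintype X] [DecidableEq X] {t : ℕ}
    {G : Finset (Finset X)} :
    WiseIntersecting 3 t G ↔ ∀ A ∈ G, ∀ B ∈ G, ∀ C ∈ G, t ≤ (A ∩ B ∩ C).card := by
  have key : ∀ g : Fin 3 → Finset X, univ.inf g = g 0 ∩ g 1 ∩ g 2 := by
    intro g
    ext x
    simp [Finset.mem_inf, Fin.forall_fin_succ]
  constructor
  · intro h A hA B hB C hC
    have := h ![A, B, C] (by simp [Fin.forall_fin_succ, hA, hB, hC])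
    simpa [key] using this
  · intro h g hg
    rw [key]
    exact h _ (hg 0) _ (hg 1) _ (hg 2)

/-- If the symmetric differences were disjoint, `A ∩ B` would lie in `S`, and `A`, `B`, `E` would
omit disjoint subsets of `S` of sizes `k`, `k`, `k + 1`. That leaves at most `t - 1` common
elements. -/
theorem not_disjoint_symmDiff {X : Type*} [DecidableEq X] {t k : ℕ} {G : Finset (Finset X)}
    {S : Finset X} (hG : ∀ A ∈ G, ∀ B ∈ G, ∀ C ∈ G, t ≤ (A ∩ B ∩ C).card)
    (hS : S.card = t + 3 * k) {E Z A B : Finset X} (hE : E ∈ G) (hZ : Z ⊆ S \ E)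
    (hZc : Z.card = k + 1) (hA : A ∈ G) (hAk : (S \ A).card = k) (hAZ : Disjoint (S \ A) Z)
    (hB : B ∈ G) (hBk : (S \ B).card = k) (hBZ : Disjoint (S \ B) Z) :
    ¬ Disjoint (symmDiff S A) (symmDiff S B) := by
  intro hd
  rw [disjoint_left] at hd
  simp only [mem_symmDiff] at hd
  have hAB : Disjoint (S \ A) (S \ B) := by
    rw [disjoint_left]
    intro x hx hx'
    rw [mem_sdiff] at hx hx'
    exact hd (Or.inl hx) (Or.inl hx')
  have hU : ((S \ A) ∪ (S \ B) ∪ Z).card = 3 * k + 1 := by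
    rw [card_union_of_disjoint (disjoint_union_left.2 ⟨hAZ, hBZ⟩), card_union_of_disjoint hAB]
    omega
  have hI : Disjoint (A ∩ B ∩ E) ((S \ A) ∪ (S \ B) ∪ Z) := by
    rw [disjoint_left]
    intro x hx hx'
    simp only [mem_inter, mem_union, mem_sdiff] at hx hx'
    rcases hx' with (h | h) | h
    · exact h.2 hx.1.1
    · exact h.2 hx.1.2
    · exact (mem_sdiff.1 (hZ h)).2 hx.2
  have hsub : (A ∩ B ∩ E) ∪ ((S \ A) ∪ (S \ B) ∪ Z) ⊆ S := by
    refine union_subset ?_ (union_subset (union_subset sdiff_subset sdiff_subset)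
      (hZ.trans sdiff_subset))
    intro x hx
    simp only [mem_inter] at hx
    by_contra hxS
    exact hd (Or.inr ⟨hx.1.1, hxS⟩) (Or.inr ⟨hx.1.2, hxS⟩)
  have h1 := card_le_card hsub
  rw [card_union_of_disjoint hI, hU, hS] at h1
  have := hG A hA B hB E hE
  omega

section Exclusion

variable {X : Type*} [Fintype X] [DecidableEq X] {p : ℝ} {t k : ℕ} {G : Finset (Finset X)}
  {S : Finset X}

/-- Outside `S` both products agree. Inside, marginal `p² / 4` reproduces `p^(2k)` up to `4^k`; the
divisor `4` lets Bernoulli's inequality keep the remaining factor above `1 / 2` when `|S| p² ≤ 2`.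
-/
theorem prod_weight_le (hp : 0 < p) (hp2 : p ≤ 1 / 2) (hS : S.card = t + 3 * k)
    (hSp : S.card * p ^ 2 ≤ 2) {A : Finset X} (hAk : (S \ A).card = k) :
    (∏ x, if x ∈ A then p else 1 - p) ≤ 2 * 4 ^ k * p ^ t *
      ∏ x, if x ∈ symmDiff S A then (if x ∈ S then p ^ 2 / 4 else p)
        else 1 - (if x ∈ S then p ^ 2 / 4 else p) := by
  have hc : (S ∩ A).card = t + 2 * k := by
    have := card_sdiff_add_card_inter S A
    omega
  rw [← prod_mul_prod_compl S, ← prod_mul_prod_compl S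
    (fun x => if x ∈ symmDiff S A then (if x ∈ S then p ^ 2 / 4 else p)
        else 1 - (if x ∈ S then p ^ 2 / 4 else p)), ← mul_assoc]
  have hout : ∏ x ∈ Sᶜ, (if x ∈ symmDiff S A then (if x ∈ S then p ^ 2 / 4 else p)
        else 1 - (if x ∈ S then p ^ 2 / 4 else p)) = ∏ x ∈ Sᶜ, if x ∈ A then p else 1 - p := by
    refine prod_congr rfl fun x hx => ?_
    rw [mem_compl] at hx
    simp [mem_symmDiff, hx]
  rw [hout]
  refine mul_le_mul_of_nonneg_right ?_ (prod_nonneg fun x _ => by split_ifs <;> linarith)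
  have hl : ∏ x ∈ S, (if x ∈ A then p else 1 - p) = p ^ (t + 2 * k) * (1 - p) ^ k := by
    rw [prod_ite, prod_const, prod_const, filter_mem_eq_inter, hc, ← sdiff_eq_filter, hAk]
  have hr : ∏ x ∈ S, (if x ∈ symmDiff S A then (if x ∈ S then p ^ 2 / 4 else p)
        else 1 - (if x ∈ S then p ^ 2 / 4 else p)) =
      (1 - p ^ 2 / 4) ^ (t + 2 * k) * (p ^ 2 / 4) ^ k := by
    rw [prod_congr rfl (g := fun x => if x ∈ A then 1 - p ^ 2 / 4 else p ^ 2 / 4)]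
    · rw [prod_ite, prod_const, prod_const, filter_mem_eq_inter, hc, ← sdiff_eq_filter, hAk]
    · intro x hx
      by_cases hxA : x ∈ A <;> simp [mem_symmDiff, hx, hxA]
  rw [hl, hr]
  have hb : (1 : ℝ) / 2 ≤ (1 - p ^ 2 / 4) ^ (t + 2 * k) := by
    have h := one_add_mul_le_pow (a := -(p ^ 2 / 4)) (by nlinarith) (t + 2 * k)
    rw [← sub_eq_add_neg] at h
    refine le_trans ?_ h
    have h3 : ((t + 2 * k : ℕ) : ℝ) ≤ S.card := by rw [hS]; exact_mod_cast (by omega)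
    nlinarith [mul_le_mul_of_nonneg_right h3 (sq_nonneg p)]
  have hq : (1 - p) ^ k ≤ 1 := pow_le_one₀ (by linarith) (by linarith)
  calc p ^ (t + 2 * k) * (1 - p) ^ k ≤ p ^ (t + 2 * k) * 1 := by gcongr
    _ = 2 * 4 ^ k * p ^ t * (1 / 2 * (p ^ 2 / 4) ^ k) := by
        rw [div_pow, pow_add, pow_mul]; field_simp
    _ ≤ _ := by gcongr

/-- If a `3`-wise `t`-intersecting family has a member outside `nearFull S k`, where
`|S| = t + 3k`, then only a small part of it lies in `nearFull S k`. -/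
theorem biasedMeasure_inter_nearFull_le
    (hG : ∀ A ∈ G, ∀ B ∈ G, ∀ C ∈ G, t ≤ (A ∩ B ∩ C).card) (hp : 0 < p) (hp2 : p ≤ 1 / 2)
    (hS : S.card = t + 3 * k) (hSp : S.card * p ^ 2 ≤ 2)
    {E : Finset X} (hE : E ∈ G) (hES : E ∉ nearFull S k) :
    biasedMeasure p (G ∩ nearFull S k) ≤ (4 ^ (k + 1) + (k + 1) * 2 ^ k) * p * p ^ t := by
  rw [mem_nearFull, not_le] at hES
  obtain ⟨Z, hZ, hZc⟩ := exists_subset_card_eq (Nat.succ_le_of_lt hES)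
  -- `Z` consists of `k + 1` points of `S` missed by `E`. Any other set in `nearFull S k` misses at
  -- most `k - 1` points of `S.erase z` for some `z ∈ Z`, which gains a factor `p`. For `k = 0`
  -- there are no such sets, and `k - 1` would truncate.
  set good := G.filter fun A => (S \ A).card = k ∧ Disjoint (S \ A) Z with hgood
  set bad := if k = 0 then ∅ else Z.biUnion fun z => nearFull (S.erase z) (k - 1) with hbad
  have hsub : G ∩ nearFull S k ⊆ good ∪ bad := by
    intro A hA
    rw [mem_inter, mem_nearFull] at hA
    by_cases hg : A ∈ good
    · exact mem_union_left _ hg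
    refine mem_union_right _ ?_
    have hg' : (S \ A).card = k → ¬ Disjoint (S \ A) Z := by
      intro h1 h2
      exact hg (mem_filter.2 ⟨hA.1, h1, h2⟩)
    have hk : k ≠ 0 := by
      rintro rfl
      have h0 : S \ A = ∅ := by simpa using hA.2
      exact hg' (by simp [h0]) (by simp [h0])
    rw [hbad, if_neg hk]
    rw [mem_biUnion]
    by_cases hlt : (S \ A).card = k
    · obtain ⟨z, hz, hzZ⟩ := not_disjoint_iff.1 (hg' hlt)
      refine ⟨z, hzZ, mem_nearFull.2 ?_⟩
      rw [erase_sdiff_comm, card_erase_of_mem hz, hlt]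
    · obtain ⟨z, hz⟩ : Z.Nonempty := card_pos.1 (by omega)
      refine ⟨z, hz, mem_nearFull.2 ?_⟩
      have := card_le_card (sdiff_subset_sdiff (erase_subset z S) (Subset.refl A))
      omega
  have hgoodm : biasedMeasure p good ≤ 4 ^ (k + 1) * p * p ^ t := by
    -- The largest `m` with `m p ≤ 1`; as `p ≤ 1 / 2`, rounding down costs at most a factor `2`.
    set m := ⌊1 / p⌋₊ with hm
    have hmp : (m : ℝ) * p ≤ 1 := by
      have := Nat.floor_le (one_div_pos.2 hp).le
      rwa [le_div_iff₀ hp] at this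
    have hm2 : 1 ≤ 2 * p * m := by
      have := Nat.lt_floor_add_one (1 / p)
      rw [div_lt_iff₀ hp] at this
      nlinarith
    have hI := mul_sum_prod_le_one_of_intersecting m (fun x => if x ∈ S then p ^ 2 / 4 else p)
      (fun x => by split_ifs <;> positivity)
      (fun x => by
        split_ifs
        · refine le_trans ?_ hmp
          gcongr
          nlinarith
        · exact hmp)
      (good.image (symmDiff S)) (by
        simp only [mem_image, forall_exists_index, and_imp, forall_apply_eq_imp_iff₂]
        intro A hA B hB
        obtain ⟨hA1, hA2, hA3⟩ := mem_filter.1 hA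
        obtain ⟨hB1, hB2, hB3⟩ := mem_filter.1 hB
        exact not_disjoint_symmDiff hG hS hE hZ hZc hA1 hA2 hA3 hB1 hB2 hB3)
    rw [sum_image (fun A _ B _ h => symmDiff_right_injective S h)] at hI
    set T := ∑ A ∈ good, ∏ x, (if x ∈ symmDiff S A then (if x ∈ S then p ^ 2 / 4 else p)
        else 1 - (if x ∈ S then p ^ 2 / 4 else p)) with hT
    have hT0 : 0 ≤ T := sum_nonneg fun A _ => prod_nonneg fun x _ => by
      split_ifs <;> nlinarith
    have hT2 : T ≤ 2 * p := by
      calc T = 1 * T := (one_mul T).symm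
        _ ≤ 2 * p * m * T := by gcongr
        _ = 2 * p * (m * T) := by ring
        _ ≤ 2 * p * 1 := by gcongr
        _ = 2 * p := mul_one _
    calc biasedMeasure p good ≤ 2 * 4 ^ k * p ^ t * T := by
          rw [biasedMeasure_eq_sum_prod, hT, mul_sum]
          exact sum_le_sum fun A hA => prod_weight_le hp hp2 hS hSp (mem_filter.1 hA).2.1
      _ ≤ 2 * 4 ^ k * p ^ t * (2 * p) := by gcongr
      _ = _ := by ring
  have hbadm : biasedMeasure p bad ≤ (k + 1) * 2 ^ k * p * p ^ t := by
    rcases Nat.eq_zero_or_pos k with hk | hk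
    · rw [hbad, if_pos hk]
      simp only [biasedMeasure, sum_empty]
      positivity
    obtain ⟨j, rfl⟩ : ∃ j, k = j + 1 := ⟨k - 1, by omega⟩
    rw [hbad, if_neg hk.ne']
    refine (biasedMeasure_biUnion_le hp.le (by linarith) _ _).trans ?_
    have hz : ∀ z ∈ Z, biasedMeasure p (nearFull (S.erase z) (j + 1 - 1)) ≤
        2 ^ (j + 1) * p * p ^ t := by
      intro z hz
      have hzS : z ∈ S := (mem_sdiff.1 (hZ hz)).1
      have hcard : (S.erase z).card = t + 3 * j + 2 := by
        rw [card_erase_of_mem hzS, hS]; omega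
      refine (biasedMeasure_nearFull_le hp.le (by linarith) _ (by omega)).trans ?_
      rw [Nat.add_sub_cancel, hcard, show t + 3 * j + 2 - j = t + 2 * j + 2 by omega]
      have h1 : ((t + 3 * j + 2).choose j : ℝ) ≤ (S.card : ℝ) ^ j := by
        have h2 : (t + 3 * j + 2).choose j ≤ (t + 3 * j + 2) ^ j := Nat.choose_le_pow _ _
        have h3 : (t + 3 * j + 2) ^ j ≤ S.card ^ j := Nat.pow_le_pow_left (by omega) _
        exact_mod_cast h2.trans h3
      calc ((t + 3 * j + 2).choose j : ℝ) * p ^ (t + 2 * j + 2)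
          ≤ (S.card : ℝ) ^ j * p ^ (t + 2 * j + 2) := by gcongr
        _ = (S.card * p ^ 2) ^ j * (p * p) * p ^ t := by rw [mul_pow]; ring
        _ ≤ 2 ^ j * (2 * p) * p ^ t := by gcongr; linarith
        _ = _ := by ring
    refine (sum_le_sum hz).trans (le_of_eq ?_)
    rw [sum_const, hZc, nsmul_eq_mul]
    push_cast; ring
  calc biasedMeasure p (G ∩ nearFull S k) ≤ biasedMeasure p (good ∪ bad) :=
        biasedMeasure_mono hp.le (by linarith) hsub
    _ ≤ biasedMeasure p good + biasedMeasure p bad :=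
        biasedMeasure_union_le hp.le (by linarith) _ _
    _ ≤ _ := by linarith

end Exclusion

/-! ### Shifting -/

section Shift

variable {X : Type*} [DecidableEq X]

/-- Replace `j` by `i` in `A` if `j ∈ A` and `i ∉ A`. -/
def shiftSet (i j : X) (A : Finset X) : Finset X :=
  if j ∈ A ∧ i ∉ A then insert i (A.erase j) else A

/-- The member of the shifted family that comes from `A ∈ G`. -/
def shiftIn (i j : X) (G : Finset (Finset X)) (A : Finset X) : Finset X :=
  if shiftSet i j A ∈ G then A else shiftSet i j A

/-- The `(i, j)`-shift of a family. -/
def shiftFamily (i j : X) (G : Finset (Finset X)) : Finset (Finset X) :=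
  G.image (shiftIn i j G)

variable {i j : X} {G : Finset (Finset X)} {A B : Finset X}

theorem shiftIn_cases (hA : A ∈ G) :
    (shiftIn i j G A = A ∧ shiftSet i j A ∈ G) ∨
      (j ∈ A ∧ i ∉ A ∧ insert i (A.erase j) ∉ G ∧ shiftIn i j G A = insert i (A.erase j)) := by
  unfold shiftIn
  by_cases h : shiftSet i j A ∈ G
  · left; simp [h]
  · right
    unfold shiftSet at h ⊢
    by_cases h' : j ∈ A ∧ i ∉ A
    · rw [if_pos h'] at h
      rw [if_pos h', if_neg h]
      exact ⟨h'.1, h'.2, h, rfl⟩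
    · rw [if_neg h'] at h
      exact absurd hA h

theorem card_shiftIn (hA : A ∈ G) : (shiftIn i j G A).card = A.card := by
  rcases shiftIn_cases (i := i) (j := j) hA with ⟨h, -⟩ | ⟨hj, hi, -, h⟩
  · rw [h]
  · rw [h, card_insert_of_notMem (fun h => hi (mem_of_mem_erase h)), card_erase_add_one hj]

theorem shiftIn_injOn : Set.InjOn (shiftIn i j G) G := by
  intro A hA B hB hAB
  have key : ∀ {A : Finset X}, j ∈ A → i ∉ A → (insert i (A.erase j)).erase i = A.erase j :=
    fun {A} _ hi => erase_insert (fun h => hi (mem_of_mem_erase h))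
  rcases shiftIn_cases (i := i) (j := j) hA with ⟨h, -⟩ | ⟨hj, hi, hn, h⟩ <;>
  rcases shiftIn_cases (i := i) (j := j) hB with ⟨h', -⟩ | ⟨hj', hi', hn', h'⟩ <;>
  rw [h, h'] at hAB
  · exact hAB
  · exact absurd (hAB ▸ hA) hn'
  · exact absurd (hAB ▸ hB) hn
  · have h1 : A.erase j = B.erase j := by rw [← key hj hi, ← key hj' hi', hAB]
    rw [← insert_erase hj, ← insert_erase hj', h1]

theorem biasedMeasure_shiftFamily [Fintype X] (p : ℝ) (i j : X) (G : Finset (Finset X)) :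
    biasedMeasure p (shiftFamily i j G) = biasedMeasure p G := by
  unfold biasedMeasure shiftFamily
  rw [sum_image shiftIn_injOn]
  exact sum_congr rfl fun A hA => by rw [card_shiftIn hA]

/-- Only `i` and `j` can change status. The common part of the preimages could shrink only by losing
`j`; then either `i` is gained in exchange, or another choice of members of `G` gives the bound. -/
theorem WiseIntersecting.shiftFamily [Fintype X] {r t : ℕ} (hG : WiseIntersecting r t G)
    (hij : i ≠ j) : WiseIntersecting r t (shiftFamily i j G) := by
  intro g hg
  have hg' : ∀ k, ∃ A ∈ G, shiftIn i j G A = g k := fun k => by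
    simpa [_root_.shiftFamily] using hg k
  choose a ha hag using hg'
  have hcase := fun k => shiftIn_cases (i := i) (j := j) (ha k)
  simp only [hag] at hcase
  by_cases hmv : ∃ k, i ∉ a k ∧ g k ≠ a k
  swap
  · have : g = a := by
      funext k
      by_contra hne
      rcases hcase k with ⟨h, -⟩ | ⟨-, hi, -, -⟩
      · exact hne h
      · exact hmv ⟨k, hi, hne⟩
    rw [this]
    exact hG a ha
  obtain ⟨k₀, hk₀, hk₀'⟩ := hmv
  have hi0 : i ∉ univ.inf a := fun h => hk₀ (by
    have := (Finset.mem_inf (f := a)).1 h k₀ (mem_univ _); exact this)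
  have hoff : ∀ k x, x ≠ i → x ≠ j → (x ∈ g k ↔ x ∈ a k) := by
    intro k x hxi hxj
    rcases hcase k with ⟨h, -⟩ | ⟨-, -, -, h⟩
    · rw [h]
    · simp [h, hxi, hxj]
  by_cases hj0 : j ∈ univ.inf a
  swap
  · refine (hG a ha).trans (card_le_card fun x hx => ?_)
    have hxi : x ≠ i := fun h => hi0 (h ▸ hx)
    have hxj : x ≠ j := fun h => hj0 (h ▸ hx)
    rw [Finset.mem_inf] at hx ⊢
    exact fun k hk => (hoff k x hxi hxj).2 (hx k hk)
  have hjall : ∀ k, j ∈ a k := fun k => (Finset.mem_inf (f := a)).1 hj0 k (mem_univ _)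
  by_cases hiall : ∀ k, i ∈ g k
  · have hsub : insert i ((univ.inf a).erase j) ⊆ univ.inf g := by
      intro x hx
      rw [Finset.mem_inf]
      rintro k -
      rcases mem_insert.1 hx with rfl | hx
      · exact hiall k
      · have hxi : x ≠ i := fun h => hi0 (h ▸ mem_of_mem_erase hx)
        exact (hoff k x hxi (ne_of_mem_erase hx)).2
          ((Finset.mem_inf (f := a)).1 (mem_of_mem_erase hx) k (mem_univ _))
    refine le_trans ?_ (card_le_card hsub)
    rw [card_insert_of_notMem (fun h => hi0 (mem_of_mem_erase h)), card_erase_add_one hj0]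
    exact hG a ha
  · obtain ⟨k₁, hk₁⟩ := not_forall.1 hiall
    -- Unmoved members have their shifts in `G`, so they may be replaced by them. The new
    -- intersection avoids `i` (because of `k₀`) and `j` (because of `k₁`), where nothing else has
    -- changed.
    let b : Fin r → Finset X := fun k => if g k = a k then shiftSet i j (a k) else a k
    have hb : ∀ k, b k ∈ G := by
      intro k
      simp only [b]
      split_ifs with h
      · rcases hcase k with ⟨-, h'⟩ | ⟨-, hi, -, h'⟩
        · exact h'
        · exact absurd (h ▸ h' ▸ mem_insert_self i _) hi
      · exact ha k
    refine (hG b hb).trans (card_le_card fun x hx => ?_)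
    rw [Finset.mem_inf] at hx ⊢
    have hxi : x ≠ i := by
      rintro rfl
      have := hx k₀ (mem_univ _)
      simp only [b, if_neg hk₀'] at this
      exact hk₀ this
    have hxj : x ≠ j := by
      rintro rfl
      have := hx k₁ (mem_univ _)
      rcases hcase k₁ with ⟨h, -⟩ | ⟨-, -, -, h⟩
      · rw [h] at hk₁
        simp only [b, if_pos h, shiftSet, if_pos (And.intro (hjall k₁) hk₁)] at this
        simp [hij.symm] at this
      · exact hk₁ (h ▸ mem_insert_self i _)
    intro k hk
    rw [hoff k x hxi hxj]
    have := hx k hk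
    simp only [b, shiftSet] at this
    split_ifs at this with h1 h2
    · simpa [hxi, hxj] using this
    · exact this
    · exact this

/-- An unmoved member is already near-full in `S`; for a moved one, the transposition of `i` and `j`
carries the bound to the image of `S`. -/
theorem subset_union_nearFull_of_shiftFamily_subset [Fintype X] {S : Finset X} {k : ℕ}
    (h : shiftFamily i j G ⊆ nearFull S k) :
    G ⊆ nearFull S k ∪ nearFull (S.image (Equiv.swap i j)) k := by
  intro A hA
  have hsA : (S \ shiftIn i j G A).card ≤ k :=
    mem_nearFull.1 (h (mem_image_of_mem _ hA))
  rw [mem_union, mem_nearFull, mem_nearFull]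
  rcases shiftIn_cases (i := i) (j := j) hA with ⟨h, -⟩ | ⟨hj, hi, -, h⟩
  · left; rwa [h] at hsA
  · right
    have hsub : S.image (Equiv.swap i j) \ A ⊆ (S \ shiftIn i j G A).image (Equiv.swap i j) := by
      intro x hx
      obtain ⟨hxS, hxA⟩ := mem_sdiff.1 hx
      obtain ⟨y, hy, rfl⟩ := mem_image.1 hxS
      refine mem_image_of_mem _ (mem_sdiff.2 ⟨hy, fun hy' => hxA ?_⟩)
      rw [h, mem_insert, mem_erase] at hy'
      rcases hy' with rfl | ⟨hyj, hyA⟩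
      · rwa [Equiv.swap_apply_left]
      · have hyi : y ≠ i := by rintro rfl; exact hi hyA
        rwa [Equiv.swap_apply_of_ne_of_ne hyi hyj]
    exact (card_le_card hsub).trans (card_image_le.trans hsA)

end Shift

/-! ### Shifted families -/

section Shifted

variable {n : ℕ}

/-- A family on `Fin n` that is stable under replacing elements by smaller ones. -/
def IsShifted (G : Finset (Finset (Fin n))) : Prop :=
  ∀ A ∈ G, ∀ i j, i < j → j ∈ A → i ∉ A → insert i (A.erase j) ∈ G

theorem sum_shiftFamily_lt {G : Finset (Finset (Fin n))} {A : Finset (Fin n)} {i j : Fin n}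
    (hA : A ∈ G) (hij : i < j) (hj : j ∈ A) (hi : i ∉ A) (hn : insert i (A.erase j) ∉ G) :
    ∑ B ∈ shiftFamily i j G, ∑ x ∈ B, (x : ℕ) < ∑ B ∈ G, ∑ x ∈ B, (x : ℕ) := by
  have hmove : ∀ B : Finset (Fin n), j ∈ B → i ∉ B →
      ∑ x ∈ insert i (B.erase j), (x : ℕ) < ∑ x ∈ B, (x : ℕ) := by
    intro B hj hi
    rw [sum_insert (fun h => hi (mem_of_mem_erase h)), ← add_sum_erase B _ hj]
    exact Nat.add_lt_add_right hij _
  unfold shiftFamily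
  rw [sum_image shiftIn_injOn]
  refine sum_lt_sum (fun B hB => ?_) ⟨A, hA, ?_⟩
  · rcases shiftIn_cases (i := i) (j := j) hB with ⟨h, -⟩ | ⟨hj, hi, -, h⟩
    · rw [h]
    · rw [h]; exact (hmove B hj hi).le
  · have hs : shiftSet i j A = insert i (A.erase j) := if_pos ⟨hj, hi⟩
    rw [shiftIn, hs, if_neg hn]
    exact hmove A hj hi

/-- Induction along shifts: a property that holds for shifted families and passes from every
shift of a family back to the family holds for all families. -/
theorem shift_induction {P : Finset (Finset (Fin n)) → Prop}
    (hshifted : ∀ G, IsShifted G → P G)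
    (hback : ∀ G i j, i ≠ j → P (shiftFamily i j G) → P G) (G : Finset (Finset (Fin n))) : P G := by
  induction h : ∑ B ∈ G, ∑ x ∈ B, (x : ℕ) using Nat.strong_induction_on generalizing G with
  | _ N ih =>
    by_cases hG : IsShifted G
    · exact hshifted G hG
    · simp only [IsShifted, not_forall] at hG
      obtain ⟨A, hA, i, j, hij, hj, hi, hn⟩ := hG
      refine hback G i j hij.ne (ih _ ?_ _ rfl)
      rw [← h]
      exact sum_shiftFamily_lt hA hij hj hi hn

/-- The smallest `a ∈ A \ B` can be replaced by a smaller element of `B \ A`, which exists by prefix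
counting. This preserves the prefix domination and shrinks `A \ B`. -/
theorem IsShifted.exists_subset {G : Finset (Finset (Fin n))} (hG : IsShifted G)
    {A B : Finset (Fin n)} (hA : A ∈ G)
    (hAB : ∀ m : ℕ, (A.filter fun x : Fin n => (x : ℕ) < m).card ≤
      (B.filter fun x : Fin n => (x : ℕ) < m).card) :
    ∃ C ∈ G, C ⊆ B := by
  induction h : (A \ B).card using Nat.strong_induction_on generalizing A with
  | _ N ih =>
    rcases (A \ B).eq_empty_or_nonempty with he | hne
    · exact ⟨A, hA, sdiff_eq_empty_iff_subset.1 he⟩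
    obtain ⟨haA, haB⟩ := mem_sdiff.1 (min'_mem _ hne)
    set a := (A \ B).min' hne with ha
    have hmin : ∀ x ∈ A, x < a → x ∈ B := by
      intro x hxA hxa
      by_contra hxB
      exact absurd (min'_le _ x (mem_sdiff.2 ⟨hxA, hxB⟩)) (not_le.2 hxa)
    obtain ⟨b, hbB, hba, hbA⟩ : ∃ b ∈ B, b ≤ a ∧ b ∉ A := by
      by_contra hcon
      push Not at hcon
      have hss : (B.filter fun x : Fin n => (x : ℕ) < a + 1) ⊂
          A.filter fun x : Fin n => (x : ℕ) < a + 1 := by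
        refine (ssubset_iff_of_subset fun x hx => ?_).2 ⟨a, by simp [haA], by simp [haB]⟩
        obtain ⟨hxB, hxa⟩ := mem_filter.1 hx
        exact mem_filter.2 ⟨hcon x hxB (Fin.le_def.2 (Nat.lt_succ_iff.1 hxa)), hxa⟩
      exact absurd (hAB (a + 1)) (not_le.2 (card_lt_card hss))
    have hlt : b < a := lt_of_le_of_ne hba fun h => haB (h ▸ hbB)
    refine ih _ ?_ (hG A hA b a hlt haA hbA) (fun m => ?_) rfl
    · rw [← h]
      refine card_lt_card ((ssubset_iff_of_subset fun x hx => ?_).2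
        ⟨a, mem_sdiff.2 ⟨haA, haB⟩, by simp [hlt.ne']⟩)
      simp only [mem_sdiff, mem_insert, mem_erase] at hx ⊢
      rcases hx with ⟨rfl | hx, hxB⟩
      · exact absurd hbB hxB
      · exact ⟨hx.2, hxB⟩
    · by_cases hm : (a : ℕ) < m
      · refine le_trans ?_ (hAB m)
        have hsub : ((insert b (A.erase a)).filter fun x : Fin n => (x : ℕ) < m) ⊆
            insert b ((A.filter fun x : Fin n => (x : ℕ) < m).erase a) := by
          intro x hx
          simp only [mem_filter, mem_insert, mem_erase] at hx ⊢
          tauto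
        refine (card_le_card hsub).trans ((card_insert_le _ _).trans (le_of_eq ?_))
        exact card_erase_add_one (mem_filter.2 ⟨haA, hm⟩)
      · refine card_le_card fun x hx => ?_
        simp only [mem_filter, mem_insert, mem_erase] at hx ⊢
        refine ⟨?_, hx.2⟩
        rcases hx.1 with rfl | hx'
        · exact hbB
        · exact hmin x hx'.2 (Fin.lt_def.2 (by omega))

/-- The initial segment of length `m` of `Fin n`. -/
def initialSegment (n m : ℕ) : Finset (Fin n) := univ.filter fun x => (x : ℕ) < m

theorem card_initialSegment {m : ℕ} (h : m ≤ n) : (initialSegment n m).card = m := by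
  unfold initialSegment
  rw [Fin.card_filter_val_lt]
  exact min_eq_right h

/-- A counterexample `A` misses at least `k + 1` points of every `[t + 3k]`. Shiftedness then yields
three members, each avoiding one residue class mod `3` of the positions from `t` on; together they
share at most `t - 1` points. -/
theorem IsShifted.exists_mem_nearFull {t : ℕ} (ht : 1 ≤ t) {G : Finset (Finset (Fin n))}
    (hG : IsShifted G) (hI : ∀ A ∈ G, ∀ B ∈ G, ∀ C ∈ G, t ≤ (A ∩ B ∩ C).card)
    {A : Finset (Fin n)} (hA : A ∈ G) :
    ∃ k, t + 3 * k ≤ n ∧ A ∈ nearFull (initialSegment n (t + 3 * k)) k := by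
  by_contra hcon
  push Not at hcon
  simp only [mem_nearFull, not_le] at hcon
  -- `x + 1` is the position counted from `1`, so `M 0` starts at position `t` itself and leaves
  -- only `t - 1` earlier points.
  let M : ℕ → Finset (Fin n) := fun r =>
    univ.filter fun x => t ≤ (x : ℕ) + 1 ∧ ((x : ℕ) + 1 - t) % 3 = r
  have key : ∀ r, ∃ C ∈ G, C ⊆ (M r)ᶜ := by
    intro r
    refine hG.exists_subset hA fun m => ?_
    have hsplit : ∀ D : Finset (Fin n), (D.filter fun x : Fin n => (x : ℕ) < m).card +
        (initialSegment n m \ D).card = (initialSegment n m).card := by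
      intro D
      rw [← card_sdiff_add_card_inter (initialSegment n m) D, add_comm]
      congr 2
      ext x
      simp [initialSegment, and_comm]
    have h1 := hsplit A
    have h2 := hsplit (M r)ᶜ
    suffices (initialSegment n m \ (M r)ᶜ).card ≤ (initialSegment n m \ A).card by omega
    by_cases hm : min m n < t
    · have : initialSegment n m \ (M r)ᶜ = ∅ := by
        ext x
        have := x.2
        simp only [initialSegment, M, mem_sdiff, mem_filter, mem_univ, true_and, mem_compl,
          not_not, notMem_empty, iff_false]
        omega
      rw [this]; simp
    -- The last `k` for which `[t + 3k]` fits in the prefix; the minimum handles `m > n`.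
    · set k := (min m n - t) / 3 with hk
      have hc := hcon k (by omega)
      have h3 : (initialSegment n m \ (M r)ᶜ).card ≤ k + 1 := by
        rw [← card_range (k + 1)]
        refine card_le_card_of_injOn (fun x => ((x : ℕ) + 1 - t) / 3) (fun x hx => ?_)
          (fun x hx y hy hxy => ?_)
        · have := x.2
          simp only [initialSegment, M, coe_sdiff, Set.mem_sdiff, coe_filter, mem_univ, true_and,
            Set.mem_ofPred_eq, coe_compl, Set.mem_compl_iff, not_not] at hx
          simp only [coe_range, Set.mem_Iio]
          omega
        · simp only [initialSegment, M, coe_sdiff, Set.mem_sdiff, coe_filter, mem_univ, true_and,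
            Set.mem_ofPred_eq, coe_compl, Set.mem_compl_iff, not_not] at hx hy hxy
          refine Fin.ext ?_
          omega
      refine h3.trans (Nat.succ_le_of_lt (hc.trans_le (card_le_card
        (sdiff_subset_sdiff (fun x hx => ?_) (Subset.refl A)))))
      simp only [initialSegment, mem_filter, mem_univ, true_and] at hx ⊢
      omega
  obtain ⟨C₀, hC₀, h₀⟩ := key 0
  obtain ⟨C₁, hC₁, h₁⟩ := key 1
  obtain ⟨C₂, hC₂, h₂⟩ := key 2
  have hle := hI C₀ hC₀ C₁ hC₁ C₂ hC₂
  have hsub : C₀ ∩ C₁ ∩ C₂ ⊆ initialSegment n (t - 1) := by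
    intro x hx
    simp only [mem_inter] at hx
    have e₀ := h₀ hx.1.1
    have e₁ := h₁ hx.1.2
    have e₂ := h₂ hx.2
    simp only [M, mem_compl, mem_filter, mem_univ, true_and] at e₀ e₁ e₂
    simp only [initialSegment, mem_filter, mem_univ, true_and]
    omega
  have h4 := card_le_card hsub
  have h5 : (initialSegment n (t - 1)).card ≤ t - 1 := by
    unfold initialSegment
    rw [Fin.card_filter_val_lt]
    exact min_le_right _ _
  omega

end Shifted

/-! ### Frankl families and the threshold -/

theorem familyIso_nearFull {n t k : ℕ} {S : Finset (Fin n)} (hS : S.card = t + 3 * k) :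
    FamilyIso (nearFull S k) (franklFamily n 3 t k) := by
  have hn : t + 3 * k ≤ n := by
    rw [← hS]; exact (card_le_univ S).trans_eq (Fintype.card_fin n)
  set T := initialSegment n (t + 3 * k) with hT
  have hTc : T.card = t + 3 * k := card_initialSegment hn
  let e : {x // x ∈ S} ≃ {x // x ∈ T} := equivOfCardEq (hS.trans hTc.symm)
  let τ : Equiv.Perm (Fin n) := e.extendSubtype
  have hST : S.image τ = T := by
    refine eq_of_subset_of_card_le (fun y hy => ?_) ?_
    · obtain ⟨x, hx, rfl⟩ := mem_image.1 hy
      exact e.extendSubtype_mem x hx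
    · rw [card_image_of_injective _ τ.injective, hS, hTc]
  have hfr : franklFamily n 3 t k = nearFull T k := by
    ext A
    have h1 : A.filter (fun x : Fin n => (x : ℕ) < t + 3 * k) = T ∩ A := by
      ext x; simp [hT, initialSegment, and_comm]
    have h2 := card_sdiff_add_card_inter T A
    simp only [franklFamily, mem_filter, mem_univ, true_and, mem_nearFull, h1]
    omega
  have himage : ∀ A : Finset (Fin n), T \ A.image τ = (S \ A).image τ := by
    intro A
    rw [← hST, image_sdiff _ _ τ.injective]
  refine ⟨τ, ?_⟩
  rw [hfr]
  ext B
  rw [mem_image]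
  constructor
  · intro hB
    have hBB : (B.image τ.symm).image τ = B := by
      rw [image_image]; simp
    refine ⟨B.image τ.symm, ?_, hBB⟩
    rw [mem_nearFull] at hB ⊢
    rwa [← hBB, himage, card_image_of_injective _ τ.injective] at hB
  · rintro ⟨A, hA, rfl⟩
    rw [mem_nearFull] at hA ⊢
    rwa [himage, card_image_of_injective _ τ.injective]

/-- `pZero t` is the positive root of `(t + 2) x² = 1 + x`. -/
theorem add_two_mul_sq_le_of_le_pZero {t : ℕ} {p : ℝ} (hp : 0 < p) (h : p ≤ pZero t) :
    (t + 2) * p ^ 2 ≤ 1 + p ∧ p ≤ 1 := by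
  have h9 : (0 : ℝ) ≤ 4 * t + 9 := by positivity
  have hs := Real.sq_sqrt h9
  have hs3 : 3 ≤ Real.sqrt (4 * t + 9) := by
    refine Real.le_sqrt_of_sq_le ?_
    have : (0 : ℝ) ≤ t := Nat.cast_nonneg t
    linarith
  unfold pZero at h
  set s := Real.sqrt (4 * t + 9)
  rw [le_div_iff₀ (by linarith)] at h
  constructor
  · have h1 : p * s ≤ 2 + p := by linarith
    have h2 : (p * s) ^ 2 ≤ (2 + p) ^ 2 := by gcongr
    rw [mul_pow, hs] at h2
    nlinarith
  · nlinarith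

theorem exists_forall_le_of_le_pZero {ε : ℝ} (hε : 0 < ε) :
    ∃ t₀ : ℕ, ∀ (t : ℕ) (p : ℝ), t₀ < t → 0 < p → p ≤ pZero t → p ≤ ε := by
  obtain ⟨N, hN⟩ := exists_nat_gt (2 / ε ^ 2)
  refine ⟨N, fun t p ht hp hpt => ?_⟩
  obtain ⟨h1, h2⟩ := add_two_mul_sq_le_of_le_pZero hp hpt
  by_contra hlt
  rw [not_le] at hlt
  rw [div_lt_iff₀ (by positivity)] at hN
  have h3 : (N : ℝ) ≤ t := by exact_mod_cast ht.le
  have h4 : (N : ℝ) * ε ^ 2 ≤ t * p ^ 2 := by gcongr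
  nlinarith [sq_nonneg p]

theorem card_mul_sq_le {X : Type*} {p : ℝ} {t k : ℕ} {S : Finset X}
    (hpt : (t + 2) * p ^ 2 ≤ 1 + p) (hS : S.card = t + 3 * k) :
    S.card * p ^ 2 ≤ 1 + p + 3 * k * p ^ 2 := by
  rw [hS]
  push_cast
  nlinarith [sq_nonneg p]

/-! ### Numerical estimates -/

section Estimates

variable {X : Type*} [Fintype X] [DecidableEq X] {p : ℝ} {t k : ℕ} {S : Finset X}

theorem biasedMeasure_nearFull_le_pow_div (hp : 0 ≤ p) (hp1 : p ≤ 1) (hS : S.card = t + 3 * k) :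
    biasedMeasure p (nearFull S k) ≤ (S.card * p ^ 2) ^ k / k.factorial * p ^ t := by
  refine (biasedMeasure_nearFull_le hp hp1 S (by omega)).trans ?_
  have h1 : (S.card.choose k : ℝ) ≤ (S.card : ℝ) ^ k / k.factorial := Nat.choose_le_pow_div k _
  rw [show S.card - k = t + 2 * k by omega]
  calc (S.card.choose k : ℝ) * p ^ (t + 2 * k)
      ≤ (S.card : ℝ) ^ k / k.factorial * p ^ (t + 2 * k) := by gcongr
    _ = _ := by rw [mul_pow, pow_add, pow_mul]; ring

theorem biasedMeasure_nearFull_le_of_large (hp : 0 < p) (hp9 : p ≤ 1 / 9)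
    (hpt : (t + 2) * p ^ 2 ≤ 1 + p) (hS : S.card = t + 3 * k) (hk : 48 ≤ k) :
    biasedMeasure p (nearFull S k) ≤ (1 / 4) ^ k * p ^ t := by
  refine (biasedMeasure_nearFull_le_pow_div hp.le (by linarith) hS).trans ?_
  refine mul_le_mul_of_nonneg_right ?_ (by positivity)
  have hk' : (48 : ℝ) ≤ k := by exact_mod_cast hk
  have hp2 : p ^ 2 ≤ 1 / 81 := by nlinarith
  have h1 : S.card * p ^ 2 ≤ 1 / 12 * (k : ℝ) := by
    have h2 := card_mul_sq_le hpt hS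
    nlinarith
  -- From `k^k / k! ≤ e^k` and `e < 3`; the constant `1 / 12` above is chosen so that `3 / 12 = 1 /
  -- 4`.
  have h3 : (k : ℝ) ^ k / k.factorial ≤ 3 ^ k := by
    refine (Real.pow_div_factorial_le_exp _ (Nat.cast_nonneg k) k).trans ?_
    rw [← mul_one (k : ℝ), Real.exp_nat_mul]
    exact pow_le_pow_left₀ (Real.exp_pos 1).le (by linarith [Real.exp_one_lt_d9]) k
  calc (S.card * p ^ 2) ^ k / k.factorial ≤ (1 / 12 * (k : ℝ)) ^ k / k.factorial := by gcongr
    _ = (1 / 12) ^ k * ((k : ℝ) ^ k / k.factorial) := by rw [mul_pow]; ring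
    _ ≤ (1 / 12) ^ k * 3 ^ k := by gcongr
    _ = (1 / 4) ^ k := by rw [← mul_pow]; norm_num

theorem biasedMeasure_nearFull_le_of_small (hp : 0 < p) (hp1 : p ≤ 1)
    (hpt : (t + 2) * p ^ 2 ≤ 1 + p) (hS : S.card = t + 3 * k) (hk : 2 ≤ k) (hk' : k ≤ 48) :
    biasedMeasure p (nearFull S k) ≤ (1 + 145 * p) ^ 48 / 2 * p ^ t := by
  refine (biasedMeasure_nearFull_le_pow_div hp.le hp1 hS).trans ?_
  refine mul_le_mul_of_nonneg_right ?_ (by positivity)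
  have hkr : (k : ℝ) ≤ 48 := by exact_mod_cast hk'
  -- `145 = 1 + 3 · 48`, using `p² ≤ p`.
  have h1 : S.card * p ^ 2 ≤ 1 + 145 * p := by
    have h2 := card_mul_sq_le hpt hS
    have h3 : p ^ 2 ≤ p := by nlinarith
    have h4 : (k : ℝ) * p ^ 2 ≤ 48 * p := by gcongr
    linarith
  have h2 : (2 : ℝ) ≤ k.factorial := by exact_mod_cast Nat.factorial_le hk
  calc (S.card * p ^ 2) ^ k / k.factorial ≤ (1 + 145 * p) ^ k / 2 := by gcongr
    _ ≤ (1 + 145 * p) ^ 48 / 2 := by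
      gcongr
      linarith

/-- `biasedMeasure_inter_nearFull_le` for `k < 48` and very small `p`. -/
theorem biasedMeasure_inter_nearFull_le_of_small {G : Finset (Finset X)}
    (hG : ∀ A ∈ G, ∀ B ∈ G, ∀ C ∈ G, t ≤ (A ∩ B ∩ C).card) (hp : 0 < p) (hp50 : p ≤ (1 / 8) ^ 50)
    (hpt : (t + 2) * p ^ 2 ≤ 1 + p) (hS : S.card = t + 3 * k) (hk : k ≤ 48)
    (hGS : ¬ G ⊆ nearFull S k) :
    biasedMeasure p (G ∩ nearFull S k) ≤ 1 / 8 * (1 / 2) ^ k * p ^ t := by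
  obtain ⟨E, hE, hES⟩ := not_subset.1 hGS
  have hkr : (k : ℝ) ≤ 48 := by exact_mod_cast hk
  have hp145 : 145 * p ≤ 1 := by
    have : ((1 : ℝ) / 8) ^ 50 ≤ 1 / 145 := by norm_num
    linarith
  have hSp : S.card * p ^ 2 ≤ 2 := by
    have h2 := card_mul_sq_le hpt hS
    have h3 : p ^ 2 ≤ p := by nlinarith
    have h4 : (k : ℝ) * p ^ 2 ≤ 48 * p := by gcongr
    linarith
  refine (biasedMeasure_inter_nearFull_le hG hp (by linarith) hS hSp hE hES).trans ?_
  refine mul_le_mul_of_nonneg_right ?_ (by positivity)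
  have h1 : ((k : ℝ) + 1) ≤ 2 ^ k := by exact_mod_cast Nat.lt_two_pow_self
  have h2 : (4 : ℝ) ^ (k + 1) + (k + 1) * 2 ^ k ≤ 5 * 4 ^ k := by
    have : (4 : ℝ) ^ k = 2 ^ k * 2 ^ k := by rw [← mul_pow]; norm_num
    rw [pow_succ, this]
    nlinarith [pow_pos (two_pos (α := ℝ)) k]
  -- The exponent `50 = 48 + 2` absorbs `4^k` for all `k ≤ 48` and still leaves a summable `(1 /
  -- 2)^k`.
  have h3 : p ≤ (1 / 8) ^ 2 * (1 / 8) ^ k := by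
    rw [← pow_add]
    exact hp50.trans (pow_le_pow_of_le_one (by norm_num) (by norm_num) (by omega))
  calc ((4 : ℝ) ^ (k + 1) + (k + 1) * 2 ^ k) * p
      ≤ 5 * 4 ^ k * ((1 / 8) ^ 2 * (1 / 8) ^ k) := by gcongr
    _ = 5 / 64 * (4 * (1 / 8)) ^ k := by rw [mul_pow]; ring
    _ = 5 / 64 * (1 / 2) ^ k := by norm_num
    _ ≤ 1 / 8 * (1 / 2) ^ k :=
      mul_le_mul_of_nonneg_right (by norm_num) (by positivity)

end Estimates

/-! ### Stability for shifted families, then for all families -/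

theorem IsShifted.exists_subset_nearFull {n t : ℕ} {p δ : ℝ} (ht : 1 ≤ t) (hp : 0 < p)
    (hp50 : p ≤ (1 / 8) ^ 50) (hpt : (t + 2) * p ^ 2 ≤ 1 + p) (hδ : 0 < δ)
    (hpδ : (1 + 145 * p) ^ 48 < 1 + 2 * δ) {G : Finset (Finset (Fin n))} (hsh : IsShifted G)
    (hG : ∀ A ∈ G, ∀ B ∈ G, ∀ C ∈ G, t ≤ (A ∩ B ∩ C).card)
    (hμ : (1 / 2 + δ) * p ^ t ≤ biasedMeasure p G) :
    ∃ k ≤ 1, ∃ S : Finset (Fin n), S.card = t + 3 * k ∧ G ⊆ nearFull S k := by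
  have hp9 : p ≤ 1 / 9 := hp50.trans (by norm_num)
  have hpt0 : 0 < p ^ t := pow_pos hp t
  by_contra hcon
  -- For `k ≤ 1` this is the assumption; for `k ≥ 2` the whole near-full family has measure below
  -- `(1 / 2 + δ) p^t`.
  have hnot : ∀ k, t + 3 * k ≤ n → ¬ G ⊆ nearFull (initialSegment n (t + 3 * k)) k := by
    intro k hk hsub
    have hS : (initialSegment n (t + 3 * k)).card = t + 3 * k := card_initialSegment hk
    have hle := hμ.trans (biasedMeasure_mono hp.le (by linarith) hsub)
    rcases Nat.lt_or_ge k 2 with h2 | h2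
    · exact hcon ⟨k, by omega, _, hS, hsub⟩
    rcases Nat.lt_or_ge k 48 with h48 | h48
    · have h := hle.trans
        (biasedMeasure_nearFull_le_of_small hp (by linarith) hpt hS h2 h48.le)
      have := le_of_mul_le_mul_right h hpt0
      linarith
    · have h := hle.trans (biasedMeasure_nearFull_le_of_large hp hp9 hpt hS h48)
      have h1 := le_of_mul_le_mul_right h hpt0
      have h3 : ((1 : ℝ) / 4) ^ k ≤ (1 / 4) ^ 1 :=
        pow_le_pow_of_le_one (by norm_num) (by norm_num) (by omega)
      linarith
  set I := (range (n + 1)).filter fun k => t + 3 * k ≤ n with hI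
  have hcover : G ⊆ I.biUnion fun k => G ∩ nearFull (initialSegment n (t + 3 * k)) k := by
    intro A hA
    obtain ⟨k, hk, hAk⟩ := hsh.exists_mem_nearFull ht hG hA
    exact mem_biUnion.2 ⟨k, mem_filter.2 ⟨mem_range.2 (by omega), hk⟩, mem_inter.2 ⟨hA, hAk⟩⟩
  have hterm : ∀ k ∈ I, biasedMeasure p (G ∩ nearFull (initialSegment n (t + 3 * k)) k) ≤
      1 / 8 * (1 / 2) ^ k * p ^ t := by
    intro k hk
    have hkn := (mem_filter.1 hk).2
    have hS : (initialSegment n (t + 3 * k)).card = t + 3 * k := card_initialSegment hkn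
    rcases Nat.lt_or_ge k 48 with h48 | h48
    · exact biasedMeasure_inter_nearFull_le_of_small hG hp hp50 hpt hS h48.le (hnot k hkn)
    · refine (biasedMeasure_mono hp.le (by linarith) inter_subset_right).trans
        ((biasedMeasure_nearFull_le_of_large hp hp9 hpt hS h48).trans ?_)
      have h3 : ((1 : ℝ) / 2) ^ k ≤ (1 / 2) ^ 3 :=
        pow_le_pow_of_le_one (by norm_num) (by norm_num) (by omega)
      have h4 : ((1 : ℝ) / 4) ^ k = (1 / 2) ^ k * (1 / 2) ^ k := by rw [← mul_pow]; norm_num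
      rw [h4]
      gcongr
      exact h3.trans (by norm_num)
  have hsum : ∑ k ∈ I, ((1 : ℝ) / 2) ^ k ≤ 2 :=
    (summable_geometric_two.sum_le_tsum I (fun _ _ => by positivity)).trans_eq tsum_geometric_two
  have htot : biasedMeasure p G ≤ 1 / 4 * p ^ t := by
    calc biasedMeasure p G
        ≤ ∑ k ∈ I, biasedMeasure p (G ∩ nearFull (initialSegment n (t + 3 * k)) k) :=
          (biasedMeasure_mono hp.le (by linarith) hcover).trans
            (biasedMeasure_biUnion_le hp.le (by linarith) _ _)
      _ ≤ ∑ k ∈ I, 1 / 8 * (1 / 2) ^ k * p ^ t := sum_le_sum hterm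
      _ = 1 / 8 * (∑ k ∈ I, ((1 : ℝ) / 2) ^ k) * p ^ t := by rw [mul_sum, sum_mul]
      _ ≤ 1 / 8 * 2 * p ^ t := by gcongr
      _ = 1 / 4 * p ^ t := by norm_num
  nlinarith

theorem exists_subset_nearFull {n t : ℕ} {p δ : ℝ} (ht : 1 ≤ t) (hp : 0 < p)
    (hp50 : p ≤ (1 / 8) ^ 50) (hpt : (t + 2) * p ^ 2 ≤ 1 + p) (hδ : 0 < δ)
    (hpδ : (1 + 145 * p) ^ 48 < 1 + 2 * δ) (G : Finset (Finset (Fin n))) :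
    WiseIntersecting 3 t G → (1 / 2 + δ) * p ^ t ≤ biasedMeasure p G →
      ∃ k ≤ 1, ∃ S : Finset (Fin n), S.card = t + 3 * k ∧ G ⊆ nearFull S k := by
  refine shift_induction
    (P := fun G => WiseIntersecting 3 t G → (1 / 2 + δ) * p ^ t ≤ biasedMeasure p G →
      ∃ k ≤ 1, ∃ S : Finset (Fin n), S.card = t + 3 * k ∧ G ⊆ nearFull S k)
    (fun G hsh hG hμ => hsh.exists_subset_nearFull ht hp hp50 hpt hδ hpδ
      (wiseIntersecting_three_iff.1 hG) hμ) (fun G i j hij ih hG hμ => ?_) G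
  have hp1 : p ≤ 1 := hp50.trans (by norm_num)
  obtain ⟨k, hk, S, hS, hsub⟩ := ih (hG.shiftFamily hij) (by rwa [biasedMeasure_shiftFamily])
  have hunion := subset_union_nearFull_of_shiftFamily_subset hsub
  set S' := S.image (Equiv.swap i j) with hS'
  have hS'c : S'.card = t + 3 * k := by
    rw [hS', card_image_of_injective _ (Equiv.injective _), hS]
  by_cases h1 : G ⊆ nearFull S k
  · exact ⟨k, hk, S, hS, h1⟩
  by_cases h2 : G ⊆ nearFull S' k
  · exact ⟨k, hk, S', hS'c, h2⟩
  -- If `G` lay in neither copy, each part would have measure at most `p^t / 8`, too little for the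
  -- union to reach `p^t / 2`.
  exfalso
  have hG' := wiseIntersecting_three_iff.1 hG
  have e1 := biasedMeasure_inter_nearFull_le_of_small hG' hp hp50 hpt hS (by omega) h1
  have e2 := biasedMeasure_inter_nearFull_le_of_small hG' hp hp50 hpt hS'c (by omega) h2
  have hle : biasedMeasure p G ≤
      biasedMeasure p (G ∩ nearFull S k) + biasedMeasure p (G ∩ nearFull S' k) := by
    refine le_trans (biasedMeasure_mono hp.le hp1 ?_) (biasedMeasure_union_le hp.le hp1 _ _)
    rw [← inter_union_distrib_left]
    exact subset_inter Subset.rfl hunion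
  have hhalf : ((1 : ℝ) / 2) ^ k ≤ 1 := pow_le_one₀ (by norm_num) (by norm_num)
  have hpt0 : 0 < p ^ t := pow_pos hp t
  nlinarith [mul_le_mul_of_nonneg_right hhalf hpt0.le]

theorem exists_pos_forall_pow_lt {δ : ℝ} (hδ : 0 < δ) :
    ∃ ε > 0, ∀ p : ℝ, 0 < p → p ≤ ε → (1 + 145 * p) ^ 48 < 1 + 2 * δ := by
  have hc : Continuous fun p : ℝ => (1 + 145 * p) ^ 48 := by fun_prop
  have h := (hc.tendsto 0).eventually_lt_const (u := 1 + 2 * δ) (by norm_num; exact hδ)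
  obtain ⟨ε, hε, hball⟩ := Metric.eventually_nhds_iff.1 h
  refine ⟨ε / 2, by positivity, fun p hp hpε => hball ?_⟩
  rw [Real.dist_eq, sub_zero, abs_of_pos hp]
  linarith

theorem theorem5 :
    ∀ δ : ℝ, 0 < δ → ∃ t₀ : ℕ, ∀ (t : ℕ) (p : ℝ), t₀ < t → 0 < p → p ≤ pZero t →
      ∀ (n : ℕ) (G : Finset (Finset (Fin n))),
        WiseIntersecting 3 t G →
        (1 / 2 + δ) * p ^ t ≤ biasedMeasure p G →
        ∃ F : Finset (Finset (Fin n)), G ⊆ F ∧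
          ((t ≤ n ∧ FamilyIso F (franklFamily n 3 t 0)) ∨
            (t + 3 ≤ n ∧ FamilyIso F (franklFamily n 3 t 1))) := by
  intro δ hδ
  obtain ⟨ε, hε, hpow⟩ := exists_pos_forall_pow_lt hδ
  obtain ⟨t₀, ht₀⟩ := exists_forall_le_of_le_pZero
    (lt_min hε (by positivity : (0 : ℝ) < (1 / 8) ^ 50))
  refine ⟨t₀, fun t p ht hp hpt n G hG hμ => ?_⟩
  have hpε := ht₀ t p ht hp hpt
  obtain ⟨k, hk, S, hS, hsub⟩ := exists_subset_nearFull (by omega) hp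
    (hpε.trans (min_le_right _ _)) (add_two_mul_sq_le_of_le_pZero hp hpt).1 hδ
    (hpow p hp (hpε.trans (min_le_left _ _))) G hG hμ
  have hn : t + 3 * k ≤ n := by
    rw [← hS]; exact (card_le_univ S).trans_eq (Fintype.card_fin n)
  refine ⟨nearFull S k, hsub, ?_⟩
  interval_cases k
  · exact Or.inl ⟨by omega, familyIso_nearFull hS⟩
  · exact Or.inr ⟨by omega, familyIso_nearFull hS⟩
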